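/- **Theorem (Executions are Strategies).** Let $T$ be either the non-empty finite powerset monad $Q$ or the finite distribution monad $D$ on $\mathbf{Set}$, with support map $\mathsf{supp}$, and let $P$ be the powerset monad. Let $\delta:TP\to PT$ be the weak distributive law $\delta(\{U_i\}_i)=\{\bigcup_i V_i\mid \emptyset\ne V_i\subseteq U_i \text{ finite}\}$ for $T=Q$, and $\delta([U_i\mapsto p_i]_i)=\{\mu^D[\varphi_i\mapsto p_i]_i\mid \varphi_i\in D(Y),\ \mathsf{supp}\,\varphi_i\subseteq U_i\}$ for $T=D$. Let $\mathsf{cl}=P\mu^T\circ\delta\circ\eta^T$ be the convex closure operator on $PT(Y)$, and let $\widetilde{PT}$ be the composite monad: $\widetilde{PT}(Y)=\{U\subseteq T(Y)\mid \mathsf{cl}(U)=U\}$, with unit $\eta^P\eta^T$ and multiplication $\mu^P\mu^T\circ P\delta$. It is ordered by inclusion, with joins $\bigvee=\mathsf{cl}\circ\bigcup$ and least element $\emptyset$. Put $K(t)=\mathsf{cl}(\{t\})$ for $t\in T(Y)$. Let $A,B,X$ be sets, $H(Y)=B+A\times Y$ and $H_X(Y)=X\times H(Y)$. Then $H_X^n(Y)=(XA)^{<n}XB+(XA)^nY$,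 and $(XA)^*XB$ is the initial $H_X$-algebra, with structure map $\alpha$ and coprojections $\kappa_n:H_X^n(0)\to(XA)^*XB$. Write $\widehat{F}$ and $\overline{F}$ for the extensions of $F=H_X^n$ to $\mathbf{Kl}(T)$ and $\mathbf{Kl}(\widetilde{PT})$, and $\odot$ for Kleisli composition. Let $c:X\to\widetilde{PT}H(X)$ be any coalgebra, and $c^*:X\to\widetilde{PT}H_X(X)$, $c^*(x)=\widetilde{PT}(u\mapsto(x,u))(c(x))$. A *strategy* $\sigma$ from $x\in X$ (written $\sigma\in\Sigma_c(x)$) is a sequence with $\sigma_0=\eta^T(x)$ and $\sigma_{n+1}:\mathrm{Im}(\sigma_n)\to T H_X^{n+1}(X)$, where $\mathrm{Im}(\sigma_n)\subseteq H_X^n(X)$ is the union of the supports of the values of $\sigma_n$, such that for all $u\in\mathrm{Im}(\sigma_n)$ $$\widehat{H_X^n}(\widehat{\pi_1})\odot\sigma_{n+1}(u)=\eta^T(u),\qquad K(\sigma_{n+1}(u))\subseteq \overline{H_X^n}(c^*)(u),$$ where $\pi_1:X\times H(X)\to X$ is the projection. Its $n$-step partial outcome $\mathsf{plays}^\sigma_n(x)\in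 T H^n_X(X)$ is the composite in $\mathbf{Kl}(T)$ of $\sigma_0,\dots,\sigma_n$ (each $\sigma_i$ corestricted to $\mathrm{Im}(\sigma_i)$). It is *finitely completing* if for some $n$ every element of $\mathrm{Im}(\sigma_n)$ is a completed play, i.e. lies in $H_X^n(0)$. With $!:X\to 0$ the unique map in $\mathbf{Kl}(\widetilde{PT})$ (constantly $\emptyset$), its *completed outcome* is $$\mathsf{plays}^\sigma_c(x)=\bigvee_{n}\ \overline{\kappa_n}\odot\overline{H_X^n}(!)\odot K(\mathsf{plays}^\sigma_n(x))\ \in\ \widetilde{PT}((XA)^*XB).$$ Then: 1. The coalgebra $\eta\circ\alpha^{-1}$ on $(XA)^*XB$ is final among $\overline{H_X}$-coalgebras in $\mathbf{Kl}(\widetilde{PT})$. Let $\mathsf{exec}_c:X\to\widetilde{PT}((XA)^*XB)$ be the unique coalgebra morphism into it from $(X,c^*)$. 2. For every $x\in X$ and $\sigma\in\Sigma_c(x)$, $\mathsf{plays}^\sigma_c(x)$ is the unique $m\in\widetilde{PT}((XA)^*XB)$ with $\pi_n\odot m=\overline{H_X^n}(!)\odot K(\mathsf{plays}^\sigma_n(x))$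 for all $n$, where $\pi_n:(XA)^*XB\to \widetilde{PT}H_X^n(0)$ sends $\kappa_n(u)$ to $\eta(u)$ and every execution outside the image of $\kappa_n$ to $\emptyset$. 3. For every $x\in X$, $$\mathsf{exec}_c(x)=\bigcup_{\sigma\in\Sigma_c(x)}\mathsf{plays}^\sigma_c(x).$$ 4. Equivalently, for all $x\in X$ and $U\in T((XA)^*XB)$: $U\in\mathsf{exec}_c(x)$ if and only if some finitely completing strategy $\sigma$ from $x$ forces $U$, i.e. satisfies $\mathsf{plays}^\sigma_c(x)=\{U\}$. -/

import Mathlib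

universe u

/-! ### Environment monads -/

/-- The structure shared by the two environment monads below (both are constructed, with every
field proved): the support map `supp : T ⟶ P`, the corestriction of an element of `T X` to its own
support, and the disintegration of `t : T X` along a map `f : X → Y`. -/
class Branching (T : Type u → Type u) [Monad T] where
  supp : ∀ {X : Type u}, T X → Set X
  supp_nonempty : ∀ {X : Type u} (t : T X), (supp t).Nonempty
  supp_pure : ∀ {X : Type u} (x : X), supp (pure x : T X) = {x}
  supp_bind : ∀ {X Y : Type u} (t : T X) (f : X → T Y),
    supp (t >>= f) = ⋃ x ∈ supp t, supp (f x)
  bind_const : ∀ {X Y : Type u} (t : T X) (v : T Y), (t >>= fun _ => v) = v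
  attach : ∀ {X : Type u} (t : T X), T {x : X // x ∈ supp t}
  map_attach : ∀ {X : Type u} (t : T X), Subtype.val <$> attach t = t
  disintegrate : ∀ {X Y : Type u} (f : X → Y) (t : T X), ∃ k : Y → T X,
    (f <$> t) >>= k = t ∧ ∀ y ∈ supp (f <$> t), supp (k y) ⊆ f ⁻¹' {y}

/-- The non-empty finite powerset `Q X`. -/
@[ext]
structure NEFinPow (X : Type u) : Type u where
  carrier : Set X
  finite : carrier.Finite
  nonempty : carrier.Nonempty

namespace NEFinPow

/-- Unit: singletons; multiplication: unions. -/
instance : Monad NEFinPow where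
  pure x := ⟨{x}, Set.finite_singleton x, Set.singleton_nonempty x⟩
  bind s f := ⟨⋃ x ∈ s.carrier, (f x).carrier, s.finite.biUnion (fun x _ => (f x).finite),
    Set.nonempty_biUnion.2 (s.nonempty.imp fun x hx => ⟨hx, (f x).nonempty⟩)⟩

theorem carrier_pure {X : Type u} (x : X) : (pure x : NEFinPow X).carrier = {x} := rfl

theorem carrier_bind {X Y : Type u} (s : NEFinPow X) (f : X → NEFinPow Y) :
    (s >>= f).carrier = ⋃ x ∈ s.carrier, (f x).carrier := rfl

instance : LawfulMonad NEFinPow := LawfulMonad.mk' _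
  (by
    intro X s
    ext1
    change (⋃ x ∈ s.carrier, ({x} : Set X)) = s.carrier
    simp)
  (by intro X Y x f; ext1; simp [carrier_bind, carrier_pure])
  (by intro X Y Z s f g; ext1; simp [carrier_bind])

theorem carrier_map {X Y : Type u} (f : X → Y) (s : NEFinPow X) :
    (f <$> s).carrier = f '' s.carrier := by
  rw [← bind_pure_comp, carrier_bind]
  ext y
  simp [carrier_pure, eq_comm]

noncomputable instance : Branching NEFinPow where
  supp s := s.carrier
  supp_nonempty s := s.nonempty
  supp_pure _ := rfl
  supp_bind _ _ := rfl
  bind_const s v := by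
    ext1
    rw [carrier_bind]
    exact Set.biUnion_const s.nonempty v.carrier
  attach s := ⟨Set.univ, by
    have := s.finite.to_subtype
    exact Set.finite_univ, by
    obtain ⟨x, hx⟩ := s.nonempty
    exact ⟨⟨x, hx⟩, trivial⟩⟩
  map_attach s := by
    ext1
    rw [carrier_map]
    simp
  disintegrate {X Y} f s := by
    classical
    refine ⟨fun y => if h : (s.carrier ∩ f ⁻¹' {y}).Nonempty then
      ⟨s.carrier ∩ f ⁻¹' {y}, s.finite.inter_of_left _, h⟩ else s, ?_, ?_⟩
    · ext1
      rw [carrier_bind, carrier_map]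
      ext x
      simp only [Set.mem_image, Set.iUnion_exists, Set.biUnion_and', Set.iUnion_iUnion_eq_right,
        Set.mem_iUnion]
      constructor
      · rintro ⟨a, ha, hx⟩
        rw [dif_pos ⟨a, ha, rfl⟩] at hx
        exact hx.1
      · intro hx
        refine ⟨x, hx, ?_⟩
        rw [dif_pos ⟨x, hx, rfl⟩]
        exact ⟨hx, rfl⟩
    · intro y hy
      rw [carrier_map] at hy
      obtain ⟨a, ha, rfl⟩ := hy
      dsimp only
      rw [dif_pos ⟨a, ha, rfl⟩]
      exact Set.inter_subset_right

end NEFinPow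

/-- The finite distributions `D X`: probability mass functions with finite support. -/
@[ext]
structure FinDist (X : Type u) : Type u where
  toPMF : PMF X
  finite : toPMF.support.Finite

namespace FinDist

/-- Unit: point masses; multiplication: averaging. -/
noncomputable instance : Monad FinDist where
  pure x := ⟨PMF.pure x, by rw [PMF.support_pure]; exact Set.finite_singleton x⟩
  bind p f := ⟨p.toPMF.bind fun x => (f x).toPMF, by
    rw [PMF.support_bind]; exact p.finite.biUnion fun x _ => (f x).finite⟩

theorem toPMF_pure {X : Type u} (x : X) : (pure x : FinDist X).toPMF = PMF.pure x := rfl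

theorem toPMF_bind {X Y : Type u} (p : FinDist X) (f : X → FinDist Y) :
    (p >>= f).toPMF = p.toPMF.bind fun x => (f x).toPMF := rfl

instance : LawfulMonad FinDist := LawfulMonad.mk' _
  (by intro X p; exact FinDist.ext (PMF.bind_pure p.toPMF))
  (by intro X Y x f; exact FinDist.ext (PMF.pure_bind x _))
  (by intro X Y Z p f g; exact FinDist.ext (PMF.bind_bind p.toPMF _ _))

theorem toPMF_map {X Y : Type u} (f : X → Y) (p : FinDist X) :
    (f <$> p).toPMF = p.toPMF.map f := rfl

noncomputable instance : Branching FinDist where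
  supp p := p.toPMF.support
  supp_nonempty p := p.toPMF.support_nonempty
  supp_pure x := PMF.support_pure x
  supp_bind p f := PMF.support_bind p.toPMF _
  bind_const p v := FinDist.ext (PMF.bind_const p.toPMF v.toPMF)
  attach p := ⟨p.toPMF.bindOnSupport fun x h => PMF.pure ⟨x, h⟩, by
    have := p.finite.to_subtype
    exact Set.toFinite _⟩
  map_attach p := by
    apply FinDist.ext
    rw [toPMF_map]
    change PMF.bind _ _ = _
    rw [← PMF.bindOnSupport_eq_bind, PMF.bindOnSupport_bindOnSupport]
    simp
  disintegrate {X Y} f p := by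
    classical
    refine ⟨fun y => if h : ∃ a ∈ f ⁻¹' {y}, a ∈ p.toPMF.support then
      ⟨p.toPMF.filter (f ⁻¹' {y}) h, by
        rw [PMF.support_filter]; exact p.finite.inter_of_right _⟩ else p, ?_, ?_⟩
    · apply FinDist.ext
      rw [toPMF_bind, toPMF_map]
      ext x
      rw [PMF.bind_apply, tsum_eq_single (f x)]
      · by_cases hx : x ∈ p.toPMF.support
        · have hex : ∃ a ∈ f ⁻¹' {f x}, a ∈ p.toPMF.support := ⟨x, rfl, hx⟩
          rw [dif_pos hex]
          change p.toPMF.map f (f x) * p.toPMF.filter (f ⁻¹' {f x}) hex x = p.toPMF x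
          rw [PMF.filter_apply, PMF.map_apply]
          have hsum : (∑' a, if f x = f a then p.toPMF a else 0)
              = ∑' a, (f ⁻¹' {f x}).indicator p.toPMF a := by
            refine tsum_congr fun a => ?_
            simp [Set.indicator_apply, eq_comm]
          rw [hsum, Set.indicator_of_mem (by simp : x ∈ f ⁻¹' {f x}), mul_left_comm,
            ENNReal.mul_inv_cancel, mul_one]
          · intro h0
            rw [ENNReal.tsum_eq_zero] at h0
            have := h0 x
            rw [Set.indicator_of_mem (by simp : x ∈ f ⁻¹' {f x})] at this
            exact hx this
          · exact p.toPMF.tsum_coe_indicator_ne_top _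
        · have h0 : p.toPMF x = 0 := (p.toPMF.apply_eq_zero_iff x).2 hx
          rw [h0, mul_eq_zero]
          right
          split_ifs with h
          · simp [PMF.filter_apply, Set.indicator_apply, h0]
          · exact h0
      · intro y hy
        rw [mul_eq_zero]
        by_cases h : ∃ a ∈ f ⁻¹' {y}, a ∈ p.toPMF.support
        · right
          rw [dif_pos h]
          exact PMF.filter_apply_eq_zero_of_notMem h (by simpa using fun h' => hy h'.symm)
        · left
          rw [PMF.apply_eq_zero_iff, PMF.support_map]
          rintro ⟨a, ha, rfl⟩
          exact h ⟨a, rfl, ha⟩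
    · intro y hy
      have hy' : y ∈ (p.toPMF.map f).support := hy
      rw [PMF.support_map] at hy'
      obtain ⟨a, ha, rfl⟩ := hy'
      have hex : ∃ a' ∈ f ⁻¹' {f a}, a' ∈ p.toPMF.support := ⟨a, rfl, ha⟩
      dsimp only
      rw [dif_pos hex]
      rw [PMF.support_filter]
      exact Set.inter_subset_left

end FinDist

/-- The two kinds of environment: nondeterministic (`T = Q`) and probabilistic (`T = D`). -/
inductive Env
  | nondeterministic
  | probabilistic

namespace Env

/-- The monad of an environment: `Q` or `D`. -/
def T : Env → Type u → Type u
  | nondeterministic => NEFinPow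
  | probabilistic => FinDist

noncomputable instance (e : Env) : Monad e.T :=
  match e with
  | nondeterministic => inferInstanceAs (Monad NEFinPow)
  | probabilistic => inferInstanceAs (Monad FinDist)

instance (e : Env) : LawfulMonad e.T :=
  match e with
  | nondeterministic => inferInstanceAs (LawfulMonad NEFinPow)
  | probabilistic => inferInstanceAs (LawfulMonad FinDist)

noncomputable instance (e : Env) : Branching e.T :=
  match e with
  | nondeterministic => inferInstanceAs (Branching NEFinPow)
  | probabilistic => inferInstanceAs (Branching FinDist)

end Env

/-! ### The weak distributive law and the composite monad -/

section Composite

open Branching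

/-- The weak distributive law `δ : T P ⟶ P T`.
For `T = Q` this reads `δ {Uᵢ}ᵢ = {⋃ᵢ Vᵢ | ∅ ≠ Vᵢ ⊆ Uᵢ finite}`, and for `T = D` it reads
`δ [Uᵢ ↦ pᵢ]ᵢ = {μ [φᵢ ↦ pᵢ]ᵢ | φᵢ a finite distribution with support contained in Uᵢ}`
(the value `k U` stands for `Vᵢ` or `φᵢ` when `U = Uᵢ`). -/
def delta {T : Type u → Type u} [Monad T] [Branching T] {X : Type u} (t : T (Set X)) :
    Set (T X) :=
  {v | ∃ k : Set X → T X, (∀ U ∈ supp t, supp (k U) ⊆ U) ∧ v = t >>= k}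

/-- The convex closure operator `P μ ∘ δ ∘ η` on `P T X`. -/
def cl {T : Type u → Type u} [Monad T] [Branching T] {X : Type u} (U : Set (T X)) :
    Set (T X) :=
  joinM '' delta (pure U : T (Set (T X)))

/-- The composite functor on objects: the convex sets of elements of `T X`. -/
@[ext]
structure PTilde (T : Type u → Type u) [Monad T] [Branching T] (X : Type u) : Type u where
  carrier : Set (T X)
  convex : cl carrier = carrier

variable {T : Type u → Type u} [Monad T] [Branching T] [LawfulMonad T]

theorem bind_congr_supp {X Y : Type u} (t : T X) (f g : X → T Y)
    (h : ∀ x ∈ supp t, f x = g x) : t >>= f = t >>= g := by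
  rw [← map_attach t, bind_map_left, bind_map_left]
  congr 1
  funext x
  exact h x.1 x.2

theorem bind_eq_attach {X Y : Type u} (t : T X) (f : X → T Y) :
    t >>= f = attach t >>= fun x => f x.1 := by
  conv_lhs => rw [← map_attach t]
  rw [bind_map_left]

theorem supp_map' {X Y : Type u} (f : X → Y) (t : T X) : supp (f <$> t) = f '' supp t := by
  rw [← bind_pure_comp, supp_bind]
  ext y
  simp [supp_pure, eq_comm]

theorem mem_cl {X : Type u} {U : Set (T X)} {v : T X} :
    v ∈ cl U ↔ ∃ w : T (T X), supp w ⊆ U ∧ v = joinM w := by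
  constructor
  · rintro ⟨_, ⟨k, hk, rfl⟩, rfl⟩
    refine ⟨k U, hk U (by simp [supp_pure]), by rw [pure_bind]⟩
  · rintro ⟨w, hw, rfl⟩
    refine ⟨w, ⟨fun _ => w, ?_, by rw [pure_bind]⟩, rfl⟩
    intro V hV
    rw [supp_pure] at hV
    rw [Set.mem_singleton_iff.1 hV]
    exact hw

theorem subset_cl {X : Type u} (U : Set (T X)) : U ⊆ cl U := fun v hv =>
  mem_cl.2 ⟨pure v, by rw [supp_pure]; simpa using hv, by simp [joinM]⟩

theorem cl_eq_iff {X : Type u} {U : Set (T X)} :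
    cl U = U ↔ ∀ {I : Type u} (w : T I) (f : I → T X), (∀ i ∈ supp w, f i ∈ U) → w >>= f ∈ U := by
  constructor
  · intro h I w f hf
    rw [← h]
    refine mem_cl.2 ⟨f <$> w, ?_, by simp [joinM]⟩
    rw [supp_map']
    rintro _ ⟨i, hi, rfl⟩
    exact hf i hi
  · intro h
    refine (subset_cl U).antisymm' ?_
    intro v hv
    obtain ⟨w, hw, rfl⟩ := mem_cl.1 hv
    exact h w id fun i hi => hw hi

theorem cl_cl {X : Type u} (U : Set (T X)) : cl (cl U) = cl U := by
  rw [cl_eq_iff]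
  intro I w f hf
  have : ∀ i : {i // i ∈ supp w}, ∃ t : T (T X), supp t ⊆ U ∧ f i.1 = joinM t :=
    fun i => mem_cl.1 (hf i.1 i.2)
  choose t ht hft using this
  refine mem_cl.2 ⟨attach w >>= t, ?_, ?_⟩
  · rw [supp_bind]
    simpa using fun i hi _ => ht ⟨i, hi⟩
  · conv_lhs => rw [← map_attach w]
    rw [bind_map_left]
    simp only [joinM, bind_assoc]
    congr 1
    funext i
    rw [hft i]
    rfl

theorem cl_empty {X : Type u} : cl (∅ : Set (T X)) = ∅ := by
  rw [cl_eq_iff]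
  intro I w f hf
  obtain ⟨i, hi⟩ := supp_nonempty w
  exact (hf i hi).elim

theorem cl_singleton {X : Type u} (t : T X) : cl ({t} : Set (T X)) = {t} := by
  rw [cl_eq_iff]
  intro I w f hf
  rw [bind_congr_supp w f (fun _ => t) hf, bind_const]
  rfl

/-- A family of choices from convex sets can be averaged into a choice that depends only on the
point reached. -/
theorem exists_choice {I Y Z : Type u} (w : T I) (a : I → T Y) (h : I → Y → T Z)
    (g : Y → Set (T Z)) (hg : ∀ y, cl (g y) = g y)
    (hh : ∀ i ∈ supp w, ∀ y ∈ supp (a i), h i y ∈ g y) :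
    ∃ h' : Y → T Z, (∀ y ∈ supp (w >>= a), h' y ∈ g y) ∧
      w >>= (fun i => a i >>= h i) = (w >>= a) >>= h' := by
  let t : T (I × Y) := w >>= fun i => (fun y => (i, y)) <$> a i
  obtain ⟨k, hk, hs⟩ := disintegrate (Prod.snd : I × Y → Y) t
  have ht : Prod.snd <$> t = w >>= a := by simp [t, map_bind]
  have hmem : ∀ p ∈ supp t, h p.1 p.2 ∈ g p.2 := by
    intro p hp
    simp only [t, supp_bind, supp_map', Set.mem_iUnion] at hp
    obtain ⟨i, hi, y, hy, rfl⟩ := hp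
    exact hh i hi y hy
  rw [ht] at hk hs
  refine ⟨fun y => k y >>= fun p => h p.1 p.2, ?_, ?_⟩
  · intro y hy
    refine cl_eq_iff.1 (hg y) _ _ fun p hp => ?_
    have h2 : p.2 = y := hs y hy hp
    have h1 : p ∈ supp t := by
      rw [← hk, supp_bind]
      exact Set.mem_biUnion hy hp
    have := hmem p h1
    rwa [h2] at this ⊢
  · rw [← bind_assoc, hk]
    simp [t]

namespace PTilde

/-- The multiplication formula of the composite monad, `μ^P μ^T ∘ P δ ∘ P T g`, on sets. -/
def bindSet {Y Z : Type u} (U : Set (T Y)) (g : Y → PTilde T Z) : Set (T Z) :=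
  ⋃ t ∈ U, joinM '' delta ((fun y => (g y).carrier) <$> t)

theorem mem_bindSet {Y Z : Type u} {U : Set (T Y)} {g : Y → PTilde T Z} {v : T Z} :
    v ∈ bindSet U g ↔
      ∃ t ∈ U, ∃ h : Y → T Z, (∀ y ∈ supp t, h y ∈ (g y).carrier) ∧ v = t >>= h := by
  simp only [bindSet, Set.mem_iUnion, exists_prop]
  refine exists_congr fun t => and_congr_right fun _ => ?_
  constructor
  · rintro ⟨_, ⟨k, hk, rfl⟩, rfl⟩
    refine ⟨fun y => joinM (k (g y).carrier), fun y hy => ?_, ?_⟩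
    · rw [← (g y).convex]
      exact mem_cl.2 ⟨_, hk _ (by rw [supp_map']; exact ⟨y, hy, rfl⟩), rfl⟩
    · simp [joinM]
  · rintro ⟨h, hh, rfl⟩
    obtain ⟨k, hk, hs⟩ := disintegrate (fun y => (g y).carrier) t
    refine ⟨_, ⟨fun V => h <$> k V, ?_, rfl⟩, ?_⟩
    · intro V hV
      rw [supp_map']
      rintro _ ⟨y, hy, rfl⟩
      have h1 : (g y).carrier = V := hs V hV hy
      rw [← h1]
      refine hh y ?_
      rw [← hk, supp_bind]
      exact Set.mem_biUnion hV hy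
    · conv_rhs => rw [← hk]
      simp [joinM]

theorem bindSet_convex {Y Z : Type u} (U : PTilde T Y) (g : Y → PTilde T Z) :
    cl (bindSet U.carrier g) = bindSet U.carrier g := by
  rw [cl_eq_iff]
  intro I w f hf
  have : ∀ i : {i // i ∈ supp w}, ∃ t ∈ U.carrier, ∃ h : Y → T Z,
      (∀ y ∈ supp t, h y ∈ (g y).carrier) ∧ f i.1 = t >>= h :=
    fun i => mem_bindSet.1 (hf i.1 i.2)
  choose t ht h hh hft using this
  obtain ⟨h', hh', he⟩ := exists_choice (attach w) t h (fun y => (g y).carrier)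
    (fun y => (g y).convex) (fun i _ => hh i)
  refine mem_bindSet.2 ⟨attach w >>= t, cl_eq_iff.1 U.convex _ _ fun i _ => ht i, h', hh', ?_⟩
  rw [← he]
  rw [bind_eq_attach w]
  congr 1
  funext i
  exact hft i

/-- The composite monad: unit `η^P η^T`, multiplication `μ^P μ^T ∘ P δ`. -/
instance : Monad (PTilde T) where
  pure x := ⟨{pure x}, cl_singleton _⟩
  bind U g := ⟨bindSet U.carrier g, bindSet_convex U g⟩

theorem carrier_pure {X : Type u} (x : X) : (pure x : PTilde T X).carrier = {pure x} := rfl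

theorem mem_bind {Y Z : Type u} {U : PTilde T Y} {g : Y → PTilde T Z} {v : T Z} :
    v ∈ (U >>= g).carrier ↔
      ∃ t ∈ U.carrier, ∃ h : Y → T Z, (∀ y ∈ supp t, h y ∈ (g y).carrier) ∧ v = t >>= h :=
  mem_bindSet

instance : LawfulMonad (PTilde T) := LawfulMonad.mk' _
  (by
    intro X U
    ext v
    change v ∈ (U >>= fun x => pure (id x)).carrier ↔ _
    rw [mem_bind]
    constructor
    · rintro ⟨t, ht, h, hh, rfl⟩
      rw [bind_congr_supp t h pure hh, bind_pure]
      exact ht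
    · intro hv
      exact ⟨v, hv, pure, fun _ _ => rfl, by rw [bind_pure]⟩)
  (by
    intro X Y x g
    ext v
    rw [mem_bind]
    constructor
    · rintro ⟨t, ht, h, hh, rfl⟩
      rw [carrier_pure, Set.mem_singleton_iff] at ht
      subst ht
      rw [pure_bind]
      exact hh x (by simp [supp_pure])
    · intro hv
      refine ⟨pure x, rfl, fun _ => v, ?_, by rw [pure_bind]⟩
      intro y hy
      rw [supp_pure, Set.mem_singleton_iff] at hy
      rwa [hy])
  (by
    intro X Y Z U f g
    ext v
    rw [mem_bind, mem_bind]
    constructor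
    · rintro ⟨_, hs, h, hh, rfl⟩
      obtain ⟨t, ht, k, hk, rfl⟩ := mem_bind.1 hs
      refine ⟨t, ht, fun x => k x >>= h, fun x hx => ?_, by rw [bind_assoc]⟩
      refine mem_bind.2 ⟨k x, hk x hx, h, fun y hy => hh y ?_, rfl⟩
      rw [supp_bind]
      exact Set.mem_biUnion hx hy
    · rintro ⟨t, ht, h, hh, rfl⟩
      have : ∀ x : {x // x ∈ supp t}, ∃ s ∈ (f x.1).carrier, ∃ l : Y → T Z,
          (∀ y ∈ supp s, l y ∈ (g y).carrier) ∧ h x.1 = s >>= l :=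
        fun x => mem_bind.1 (hh x.1 x.2)
      choose s hs l hl hhl using this
      obtain ⟨h', hh', he⟩ := exists_choice (attach t) s l (fun y => (g y).carrier)
        (fun y => (g y).convex) (fun i _ => hl i)
      have hst : (attach t >>= s) ∈ (U >>= f).carrier := by
        classical
        refine mem_bind.2 ⟨t, ht, fun x => if hx : x ∈ supp t then s ⟨x, hx⟩ else
          s (supp_nonempty (attach t)).some, fun x hx => ?_, ?_⟩
        · dsimp only
          rw [dif_pos hx]
          exact hs ⟨x, hx⟩
        · rw [bind_eq_attach t]
          congr 1
          funext x
          rw [dif_pos x.2]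
      refine ⟨_, hst, h', hh', ?_⟩
      rw [← he]
      rw [bind_eq_attach t]
      congr 1
      funext x
      exact hhl x)

theorem carrier_map {X Y : Type u} (f : X → Y) (U : PTilde T X) :
    (f <$> U).carrier = (fun t => f <$> t) '' U.carrier := by
  rw [← bind_pure_comp]
  ext v
  rw [mem_bind]
  constructor
  · rintro ⟨t, ht, h, hh, rfl⟩
    exact ⟨t, ht, by rw [bind_congr_supp t h (fun x => pure (f x)) hh, bind_pure_comp]⟩
  · rintro ⟨t, ht, rfl⟩
    exact ⟨t, ht, fun x => pure (f x), fun _ _ => rfl, by rw [bind_pure_comp]⟩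

/-- The least element, the empty set of collections. -/
instance {X : Type u} : Bot (PTilde T X) := ⟨⟨∅, cl_empty⟩⟩

/-- The join of a family in the complete lattice of convex sets: the closure of the union. -/
def join {X : Type u} {ι : Type*} (U : ι → PTilde T X) : PTilde T X :=
  ⟨cl (⋃ i, (U i).carrier), cl_cl _⟩

/-- The identity-on-objects functor `K : Kl(T) ⥤ Kl(P̃T)` on Kleisli elements: `cl ∘ η^P`. -/
def K {X : Type u} (t : T X) : PTilde T X := ⟨cl {t}, cl_cl _⟩

end PTilde

end Composite

/-! ### The linear functors `H` and `H_X` and their Kleisli extensions -/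

/-- The linear functor `H Y = B + A × Y`. -/
abbrev H (A B Y : Type u) : Type u := B ⊕ A × Y

/-- The linear functor `H_X Y = X × H Y`. -/
abbrev HX (A B X Y : Type u) : Type u := X × H A B Y

namespace HX

variable {A B X : Type u}

/-- The action of `H_X` on functions. -/
def map {Y Z : Type u} (f : Y → Z) : HX A B X Y → HX A B X Z :=
  Prod.map id (Sum.map id (Prod.map id f))

/-- The distributive law `λ : H_X M ⟶ M H_X` of a linear functor over a monad. -/
def dist {M : Type u → Type u} [Monad M] {Y : Type u} : HX A B X (M Y) → M (HX A B X Y)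
  | (x, Sum.inl b) => pure (x, Sum.inl b)
  | (x, Sum.inr (a, m)) => (fun y => (x, Sum.inr (a, y))) <$> m

end HX

/-- The iterates `H_X^n Y`, i.e. `(XA)^{<n} X B + (XA)^n Y`. -/
def HXn (A B X : Type u) : ℕ → Type u → Type u
  | 0, Y => Y
  | n + 1, Y => HXn A B X n (HX A B X Y)

namespace HXn

variable {A B X : Type u}

/-- The action of `H_X^n` on functions. -/
def map : (n : ℕ) → {Y Z : Type u} → (Y → Z) → HXn A B X n Y → HXn A B X n Z
  | 0, _, _, f => f
  | n + 1, _, _, f => map n (HX.map f)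

/-- The distributive law `λ_n : H_X^n M ⟶ M H_X^n`. -/
def dist {M : Type u → Type u} [Monad M] :
    (n : ℕ) → {Y : Type u} → HXn A B X n (M Y) → M (HXn A B X n Y)
  | 0, _ => id
  | n + 1, _ => fun u => dist n (map n HX.dist u)

/-- The extension of `H_X^n` to the Kleisli category of `M`, on a Kleisli map `Y → M Z`. -/
def ext {M : Type u → Type u} [Monad M] (n : ℕ) {Y Z : Type u} (f : Y → M Z) :
    HXn A B X n Y → M (HXn A B X n Z) :=
  fun u => dist n (map n f u)

end HXn

/-- Executions, the elements `x₀ a₁ x₁ … aₙ xₙ b` of `(XA)^* X B`: the initial `H_X`-algebra. -/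
inductive Exec (A B X : Type u) : Type u
  | last (x : X) (b : B) : Exec A B X
  | step (x : X) (a : A) (e : Exec A B X) : Exec A B X

namespace Exec

variable {A B X : Type u}

/-- The structure map `α` of the initial `H_X`-algebra. -/
def mk : HX A B X (Exec A B X) → Exec A B X
  | (x, Sum.inl b) => last x b
  | (x, Sum.inr (a, e)) => step x a e

/-- The inverse of `α`. -/
def out : Exec A B X → HX A B X (Exec A B X)
  | last x b => (x, Sum.inl b)
  | step x a e => (x, Sum.inr (a, e))

theorem mk_out (e : Exec A B X) : mk (out e) = e := by cases e <;> rfl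

theorem out_mk (u : HX A B X (Exec A B X)) : out (mk u) = u := by
  rcases u with ⟨x, b | ⟨a, e⟩⟩ <;> rfl

/-- The map `H_X^n Y → (XA)^* X B` obtained from `g : Y → (XA)^* X B` by iterating `α`. -/
def fold : (n : ℕ) → {Y : Type u} → (Y → Exec A B X) → HXn A B X n Y → Exec A B X
  | 0, _, g => g
  | n + 1, _, g => fold n (fun u => mk (HX.map g u))

/-- The coprojections `κ_n : H_X^n 0 → (XA)^* X B` of the initial sequence. -/
def kappa (n : ℕ) : HXn A B X n PEmpty.{u + 1} → Exec A B X := fold n PEmpty.elim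

end Exec

/-! ### The final coalgebra and the execution coalgebra -/

section Coalgebras

open CategoryTheory

variable (T : Type u → Type u) [Monad T] [Branching T] [LawfulMonad T] (A B X : Type u)

/-- The composite monad `P̃T` as a monad on the category of types. -/
abbrev PTMonad : CategoryTheory.Monad (Type u) := ofTypeMonad (PTilde T)

variable {T} in
/-- The function underlying a Kleisli morphism. -/
def klFun {Y Z : Kleisli (PTMonad T)} (f : Y ⟶ Z) : Y.of → PTilde T Z.of := fun y => f.of y

variable {T} in
theorem klFun_comp {Y Z W : Kleisli (PTMonad T)} (f : Y ⟶ Z) (g : Z ⟶ W) :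
    klFun (f ≫ g) = fun y => klFun f y >>= klFun g := by
  funext y
  change joinM (klFun g <$> klFun f y) = _
  simp [joinM]

variable {T} in
theorem klFun_id (Y : Kleisli (PTMonad T)) : klFun (𝟙 Y) = fun y => pure y := rfl

variable {T} in
theorem kl_ext {Y Z : Kleisli (PTMonad T)} {f g : Y ⟶ Z} (h : klFun f = klFun g) : f = g := by
  ext y
  exact congrFun h y

/-- The extension of `H_X` to the Kleisli category of `P̃T`. -/
def HXbar : Kleisli (PTMonad T) ⥤ Kleisli (PTMonad T) where
  obj Y := Kleisli.mk _ (HX A B X Y.of)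
  map {Y Z} f := Kleisli.Hom.mk (↾ fun u : HX A B X Y.of =>
    (HX.dist (HX.map (klFun f) u) : PTilde T (HX A B X Z.of)))
  map_id Y := by
    apply kl_ext
    rw [klFun_id]
    funext u
    rcases u with ⟨x, b | ⟨a, y⟩⟩
    · rfl
    · exact map_pure (f := PTilde T) (fun y => ((x, Sum.inr (a, y)) : HX A B X Y.of)) y
  map_comp {Y Z W} f g := by
    apply kl_ext
    funext u
    refine Eq.trans ?_ (congrFun (klFun_comp _ _).symm u)
    change (HX.dist (HX.map (klFun (f ≫ g)) u) : PTilde T (HX A B X W.of)) =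
      (HX.dist (HX.map (klFun f) u) : PTilde T (HX A B X Z.of)) >>=
        fun v => HX.dist (HX.map (klFun g) v)
    rw [klFun_comp]
    rcases u with ⟨x, b | ⟨a, y⟩⟩
    · simp [HX.dist, HX.map]
    · simp [HX.dist, HX.map, map_bind]

/-- The coalgebra `J(α⁻¹)` on the set of executions. -/
def execCoalg : Endofunctor.Coalgebra (HXbar T A B X) where
  V := Kleisli.mk _ (Exec A B X)
  str := Kleisli.Hom.mk (↾ fun e : Exec A B X => (pure e.out : PTilde T _))

variable {T A B X}

/-- The state-recording coalgebra `c^* = stl ∘ ⟨id, c⟩`. -/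
def star (c : X → PTilde T (H A B X)) : X → PTilde T (HX A B X X) :=
  fun x => (fun u => (x, u)) <$> c x

/-- `c^*` as a coalgebra in the Kleisli category. -/
def starCoalg (c : X → PTilde T (H A B X)) : Endofunctor.Coalgebra (HXbar T A B X) where
  V := Kleisli.mk _ X
  str := Kleisli.Hom.mk (↾ star c)

/-- The execution map `exec_c`: the unique coalgebra morphism from `c^*` to the
executions coalgebra, once the latter is known to be final. -/
def execMap (final : Limits.IsTerminal (execCoalg T A B X)) (c : X → PTilde T (H A B X)) :
    X → PTilde T (Exec A B X) :=
  klFun (final.from (starCoalg c)).f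

end Coalgebras

/-! ### Strategies and their outcomes -/

section Strategies

open Branching

variable {T : Type u → Type u} [Monad T] [Branching T] [LawfulMonad T] {A B X : Type u}

/-- A strategy from `x`: a chain of Kleisli maps `σ_0 = η x` and
`σ_{n+1} : Im σ_n → T (H_X^{n+1} X)` (here `move n`, with `im n = Im σ_n`), such that
`σ_{n+1}` extends plays and picks successors allowed by the game. -/
structure Strategy (c : X → PTilde T (H A B X)) (x : X) where
  im : (n : ℕ) → Set (HXn A B X n X)
  move : (n : ℕ) → im n → T (HXn A B X (n + 1) X)
  im_zero : im 0 = supp (pure x : T X)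
  im_succ : ∀ n, im (n + 1) = ⋃ u : im n, supp (move n u)
  extend : ∀ n (u : im n),
    (move n u >>= HXn.ext n (fun w : HX A B X X => (pure w.1 : T X))) = pure u.1
  choose : ∀ n (u : im n),
    (PTilde.K (move n u)).carrier ⊆ (HXn.ext n (star c) u.1).carrier

namespace Strategy

variable {c : X → PTilde T (H A B X)} {x : X} (σ : Strategy c x)

/-- The corestriction `Im σ_n → T (Im σ_{n+1})` of `σ_{n+1}`. -/
def step (n : ℕ) (u : σ.im n) : T (σ.im (n + 1)) :=
  (fun v => ⟨v.1, by rw [σ.im_succ]; exact Set.mem_iUnion.2 ⟨u, v.2⟩⟩) <$> attach (σ.move n u)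

/-- The Kleisli composite `1 → T (Im σ_n)` of the corestrictions. -/
def playsIm : (n : ℕ) → T (σ.im n)
  | 0 => (fun v => ⟨v.1, by rw [σ.im_zero]; exact v.2⟩) <$> attach (pure x : T X)
  | n + 1 => playsIm n >>= σ.step n

/-- The `n`-step partial outcome `plays_n^σ(x)`. -/
def plays (n : ℕ) : T (HXn A B X n X) := Subtype.val <$> σ.playsIm n

/-- The cone `1 → H_X^n X → H_X^n 0` over the final sequence in `Kl(P̃T)`; the second map is the
extension of the unique (bottom) Kleisli map `! : X → 0`. -/
def cone (n : ℕ) : PTilde T (HXn A B X n PEmpty.{u + 1}) :=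
  PTilde.K (σ.plays n) >>= HXn.ext n (fun _ => ⊥)

/-- The completed outcome `plays_c^σ(x)`, as the join over `n` of the partial outcomes that contain
completed plays only. -/
def outcome : PTilde T (Exec A B X) :=
  PTilde.join fun n => σ.cone n >>= fun u => pure (Exec.kappa n u)

/-- `σ` is finitely completing: after some number of steps, all conforming plays are completed. -/
def FinitelyCompleting : Prop :=
  ∃ n, σ.im n ⊆ Set.range (HXn.map n (PEmpty.elim : PEmpty.{u + 1} → X))

end Strategy

open Classical in
/-- The projection `π_n : (XA)^* X B → H_X^n 0` in `Kl(P̃T)` associated with the embedding `J κ_n`: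
it sends an execution in the image of `κ_n` to (the unit at) its preimage, and all others to `⊥`. -/
noncomputable def piProj (n : ℕ) (e : Exec A B X) :
    PTilde T (HXn A B X n PEmpty.{u + 1}) :=
  if h : ∃ u, Exec.kappa n u = e then pure h.choose else ⊥

end Strategies

/-! A morphism into the executions is a fixed point of `unfoldStep d`, since `mk` and `out` are
inverse. Such an `f` equals `iter d n` followed by `run n f`. Two facts make this decisive. An
element `U` of `T (Exec A B X)` has finite support, so its executions all lie in the image of one
`kappa n`. A play still open after `n` steps can only be completed to executions outside that image
(`fold_id_plug_notMem_range_kappa`). Hence `U` belongs to `f y` exactly when `U = kappa n <$> s` for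
some `n` and `s` with `closed n <$> s` in `iter d n y` (`exists_mem_iter_of_isFixedPt`,
`map_kappa_mem_iterate`). This condition does not mention `f`, so fixed points are unique. One
exists as the union of the iterates from `⊥`: convexity and the fixed-point equation involve only
finitely many choices at a time, so all of them can be made in a single iterate.

Binding in `PTilde T` means choosing an element at each point reached, which is what a strategy
does. So the partial outcomes of strategies lie in `iter (star c) n x` (`plays_mem_iter`).
Conversely, an element of `iter (star c) n x` consisting of completed plays comes from a strategy,
because completed plays can stand still forever (`exists_plays_eq`). Combined with the description
of fixed points, this identifies executions with outcomes.

A strategy has at most one completed outcome, since completed plays never change. Membership in its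
cone and in `m >>= piProj n` both become equations on elements (`mem_cone`, `mem_bind_piProj`),
which gives the characterisation of the outcome by projections. -/

namespace HXn

/-! ### Completed plays and open plays -/

variable {A B X : Type u}

theorem map_map (n : ℕ) {Y Z W : Type u} (f : Y → Z) (g : Z → W) (u : HXn A B X n Y) :
    map n g (map n f u) = map n (fun y => g (f y)) u := by
  induction n generalizing Y Z W with
  | zero => rfl
  | succ n ih =>
    refine (ih (HX.map f) (HX.map g) u).trans ?_
    change map n _ u = map n (HX.map fun y => g (f y)) u
    congr 1
    funext v
    rcases v with ⟨x, b | ⟨a, y⟩⟩ <;> rfl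

theorem map_id (n : ℕ) {Y : Type u} (u : HXn A B X n Y) : map n (fun y => y) u = u := by
  induction n generalizing Y with
  | zero => rfl
  | succ n ih =>
    refine Eq.trans ?_ (ih (Y := HX A B X Y) u)
    change map n (HX.map fun y => y) u = _
    congr 1
    funext v
    rcases v with ⟨x, b | ⟨a, y⟩⟩ <;> rfl

/-- Play prefixes `x₀ a₁ x₁ a₂ … xₙ₋₁ aₙ`, with a hole behind the last action. -/
def Ctx (A X : Type u) : ℕ → Type u
  | 0 => PUnit
  | n + 1 => Ctx A X n × X × A

/-- The incomplete play with a given prefix and a given last entry. -/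
def plug : (n : ℕ) → {Y : Type u} → Ctx A X n → Y → HXn A B X n Y
  | 0, _, _, y => y
  | n + 1, _, l, y => plug n l.1 (l.2.1, Sum.inr (l.2.2, y))

/-- A completed play, seen as a play over an arbitrary set. -/
def closed (n : ℕ) {Y : Type u} (u : HXn A B X n PEmpty.{u + 1}) : HXn A B X n Y :=
  map n PEmpty.elim u

theorem map_plug (n : ℕ) {Y Z : Type u} (f : Y → Z) (l : Ctx A X n) (y : Y) :
    map n f (plug n l y : HXn A B X n Y) = plug n l (f y) := by
  induction n generalizing Y Z with
  | zero => rfl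
  | succ n ih => exact ih (HX.map f) l.1 (l.2.1, Sum.inr (l.2.2, y))

theorem map_closed (n : ℕ) {Y Z : Type u} (f : Y → Z) (u : HXn A B X n PEmpty.{u + 1}) :
    map n f (closed n u) = closed n u := by
  rw [closed, map_map, closed]
  congr 1
  funext y
  exact y.elim

theorem map_injective (n : ℕ) {Y Z : Type u} {f : Y → Z} (hf : Function.Injective f) :
    Function.Injective (map n f : HXn A B X n Y → HXn A B X n Z) := by
  induction n generalizing Y Z with
  | zero => exact hf
  | succ n ih =>
    exact ih (Function.injective_id.prodMap
      (Function.injective_id.sumMap (Function.injective_id.prodMap hf)))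

theorem closed_injective (n : ℕ) {Y : Type u} :
    Function.Injective (closed n : _ → HXn A B X n Y) :=
  map_injective n fun y => y.elim

theorem closed_self (n : ℕ) (u : HXn A B X n PEmpty.{u + 1}) : closed n u = u := by
  conv_rhs => rw [← map_id n u]
  rw [closed]
  congr 1
  funext y
  exact y.elim

/-- A completed play of length `n` as a completed play of length `n + 1`. -/
def lift (n : ℕ) (u : HXn A B X n PEmpty.{u + 1}) : HXn A B X (n + 1) PEmpty.{u + 1} :=
  closed n u

theorem closed_lift (n : ℕ) {Y : Type u} (u : HXn A B X n PEmpty.{u + 1}) :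
    (closed (n + 1) (lift n u) : HXn A B X (n + 1) Y) = closed (Y := HX A B X Y) n u :=
  map_closed n _ u

/-- As `H_X^{n+1} Y` is `H_X^n (H_X Y)` by definition, the entry in the hole at depth `n` either
ends in an output, which completes the play, or carries an action, which lengthens the prefix. -/
theorem closed_or_plug (n : ℕ) {Y : Type u} (u : HXn A B X n Y) :
    (∃ u₀, u = closed n u₀) ∨ ∃ l y, u = plug n l y := by
  induction n generalizing Y with
  | zero => exact Or.inr ⟨PUnit.unit, u, rfl⟩
  | succ n ih =>
    rcases ih (Y := HX A B X Y) u with ⟨u₀, h⟩ | ⟨l, ⟨x, b | ⟨a, y⟩⟩, h⟩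
    · exact Or.inl ⟨lift n u₀, h.trans (closed_lift n u₀).symm⟩
    · exact Or.inl ⟨plug (Y := HX A B X PEmpty) n l (x, Sum.inl b),
        h.trans (map_plug n (HX.map PEmpty.elim) l (x, Sum.inl b)).symm⟩
    · exact Or.inr ⟨(l, x, a), y, h⟩

section Monad

variable {M : Type u → Type u} [Monad M] [LawfulMonad M]

theorem dist_map_pure (n : ℕ) {Y : Type u} (u : HXn A B X n Y) :
    dist n (map n (fun y => (pure y : M Y)) u) = pure u := by
  induction n generalizing Y with
  | zero => rfl
  | succ n ih =>
    refine Eq.trans ?_ (ih (Y := HX A B X Y) u)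
    change dist n (map n HX.dist (map n (HX.map fun y => (pure y : M Y)) u)) = _
    refine congrArg (dist n) ((map_map n _ _ u).trans (congrArg (fun f => map n f u) ?_))
    funext v
    rcases v with ⟨x, b | ⟨a, y⟩⟩
    · rfl
    · exact map_pure (f := M) (fun y => ((x, Sum.inr (a, y)) : HX A B X Y)) y

theorem dist_plug (n : ℕ) {Y : Type u} (l : Ctx A X n) (m : M Y) :
    dist n (plug n l m : HXn A B X n (M Y)) = plug n l <$> m := by
  induction n generalizing Y with
  | zero => exact (id_map m).symm
  | succ n ih =>
    change dist n (map n HX.dist (plug n l.1 (l.2.1, Sum.inr (l.2.2, m)))) = _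
    rw [map_plug, ih]
    simp only [HX.dist, Functor.map_map]
    rfl

/-- A completed play over `M Z` is also the image under `pure` of the same play over `Z`, so the
unit law of `dist` applies whatever `f` is. -/
theorem ext_closed (n : ℕ) {Y Z : Type u} (f : Y → M Z) (u : HXn A B X n PEmpty.{u + 1}) :
    ext n f (closed n u) = pure (closed n u) := by
  rw [ext, map_closed, ← dist_map_pure, map_closed]

theorem ext_plug (n : ℕ) {Y Z : Type u} (f : Y → M Z) (l : Ctx A X n) (y : Y) :
    ext n f (plug n l y : HXn A B X n Y) = plug n l <$> f y := by
  rw [ext, map_plug, dist_plug]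

end Monad

/-- The constant Kleisli map `none` of the `Option` monad separates the two: it leaves a completed
play intact and sends an open one to `none`. -/
theorem closed_ne_plug (n : ℕ) {Y : Type u} (u : HXn A B X n PEmpty.{u + 1}) (l : Ctx A X n)
    (y : Y) : closed n u ≠ plug n l y := by
  intro h
  have h' := congrArg (ext (M := Option) n fun _ => (none : Option Y)) h
  rw [ext_closed, ext_plug] at h'
  cases h'

end HXn

/-! ### Executions and the coprojections -/

namespace Exec

open HXn

variable {A B X : Type u}

theorem mk_injective : Function.Injective (mk : HX A B X (Exec A B X) → Exec A B X) :=
  Function.LeftInverse.injective out_mk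

theorem fold_injective (n : ℕ) {Y : Type u} {g : Y → Exec A B X} (hg : Function.Injective g) :
    Function.Injective (fold n g : HXn A B X n Y → Exec A B X) := by
  induction n generalizing Y with
  | zero => exact hg
  | succ n ih =>
    exact ih (mk_injective.comp (Function.injective_id.prodMap
      (Function.injective_id.sumMap (Function.injective_id.prodMap hg))))

theorem kappa_injective (n : ℕ) : Function.Injective (kappa n : _ → Exec A B X) :=
  fold_injective n fun y => y.elim

theorem fold_map (n : ℕ) {Y Z : Type u} (f : Y → Z) (g : Z → Exec A B X) (u : HXn A B X n Y) :
    fold n g (map n f u) = fold n (fun y => g (f y)) u := by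
  induction n generalizing Y Z with
  | zero => rfl
  | succ n ih =>
    refine (ih (HX.map f) (fun u => mk (HX.map g u)) u).trans ?_
    change _ = fold n (fun u => mk (HX.map (fun y => g (f y)) u)) u
    congr 1
    funext v
    rcases v with ⟨x, b | ⟨a, y⟩⟩ <;> rfl

/-- Supplies a default value for moves that must be total functions. -/
theorem nonempty_succ (e : Exec A B X) (n : ℕ) {Y : Type u} : Nonempty (HXn A B X (n + 1) Y) := by
  obtain ⟨x, ⟨b⟩⟩ : ∃ _ : X, Nonempty B := by
    induction e with
    | last x b => exact ⟨x, ⟨b⟩⟩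
    | step _ _ _ ih => exact ih
  induction n generalizing Y with
  | zero => exact ⟨(x, Sum.inl b)⟩
  | succ n ih => exact ih (Y := HX A B X Y)

theorem fold_closed (n : ℕ) {Y : Type u} (g : Y → Exec A B X) (u : HXn A B X n PEmpty.{u + 1}) :
    fold n g (closed n u) = kappa n u := by
  rw [closed, fold_map, kappa]
  congr 1
  funext y
  exact y.elim

theorem kappa_lift (n : ℕ) (u : HXn A B X n PEmpty.{u + 1}) :
    kappa (n + 1) (lift n u) = kappa n u :=
  fold_closed n (fun u => mk (HX.map PEmpty.elim u)) u

theorem fold_plug (n : ℕ) {Y : Type u} (g : Y → Exec A B X) (l : Ctx A X n) (y : Y) :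
    fold n g (plug n l y : HXn A B X n Y) = fold n id (plug n l (g y) : HXn A B X n _) := by
  rw [← map_plug n g, fold_map]
  rfl

theorem fold_id_plug_succ (n : ℕ) (l : Ctx A X n) (x : X) (a : A) (e : Exec A B X) :
    fold (n + 1) id (plug (n + 1) (l, x, a) e : HXn A B X (n + 1) (Exec A B X)) =
      fold n id (plug n l (step x a e) : HXn A B X n (Exec A B X)) :=
  fold_plug n (fun u => mk (HX.map id u)) l (x, Sum.inr (a, e))

/-- The arbitrary prefix makes the induction on `e` work: each step of `e` is moved to the end of
the prefix. -/
theorem fold_plug_mem_range_kappa (e : Exec A B X) (n : ℕ) (l : Ctx A X n) :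
    ∃ m, fold n id (plug n l e : HXn A B X n (Exec A B X)) ∈ Set.range (kappa m) := by
  induction e generalizing n with
  | last x b =>
    exact ⟨n + 1, plug (Y := HX A B X PEmpty) n l (x, Sum.inl b),
      fold_plug n (fun u => mk (HX.map PEmpty.elim u)) l (x, Sum.inl b)⟩
  | step x a e ih =>
    rw [← fold_id_plug_succ]
    exact ih (n + 1) (l, x, a)

theorem exists_mem_range_kappa (e : Exec A B X) : ∃ n, e ∈ Set.range (kappa n) :=
  fold_plug_mem_range_kappa e 0 PUnit.unit

theorem range_kappa_mono : Monotone fun n => Set.range (kappa n : _ → Exec A B X) :=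
  monotone_nat_of_le_succ fun n => by
    rintro _ ⟨u, rfl⟩
    exact ⟨lift n u, kappa_lift n u⟩

/-- Both sides are values of the injective `fold n id`, one at a completed play and one at an open
play. -/
theorem fold_id_plug_notMem_range_kappa (n : ℕ) (l : Ctx A X n) (e : Exec A B X) :
    fold n id (plug n l e : HXn A B X n (Exec A B X)) ∉ Set.range (kappa n) := by
  rintro ⟨u, hu⟩
  rw [← fold_closed n id] at hu
  exact closed_ne_plug n u l e (fold_injective n Function.injective_id hu)

end Exec

/-! ### Finite unfoldings of a coalgebra -/

namespace Exec

open HXn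

section Monad

variable {M : Type u → Type u} [Monad M] [LawfulMonad M] {A B X : Type u}

/-- Complete the open end of a play of length `n` by a Kleisli map into executions. -/
def run (n : ℕ) {Y : Type u} (g : Y → M (Exec A B X)) (u : HXn A B X n Y) : M (Exec A B X) :=
  fold n id <$> ext n g u

/-- Complete the open end of a play of length one by a Kleisli map into executions. -/
def runStep {Y : Type u} (g : Y → M (Exec A B X)) (u : HX A B X Y) : M (Exec A B X) :=
  mk <$> HX.dist (HX.map g u)

theorem run_closed (n : ℕ) {Y : Type u} (g : Y → M (Exec A B X))
    (u : HXn A B X n PEmpty.{u + 1}) : run n g (closed n u) = pure (kappa n u) := by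
  rw [run, ext_closed, map_pure, fold_closed]

theorem run_plug (n : ℕ) {Y : Type u} (g : Y → M (Exec A B X)) (l : Ctx A X n) (y : Y) :
    run n g (plug n l y) = (fun e => fold n id (plug n l e : HXn A B X n _)) <$> g y := by
  rw [run, ext_plug, Functor.map_map]

theorem run_zero {Y : Type u} (g : Y → M (Exec A B X)) (y : Y) : run 0 g y = g y :=
  id_map (g y)

theorem run_succ (n : ℕ) {Y : Type u} (g : Y → M (Exec A B X)) (u : HXn A B X (n + 1) Y) :
    run (n + 1) g u = run n (runStep g) u := by
  have h : ext (n + 1) g u = ext n (fun w => HX.dist (HX.map g w)) u :=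
    congrArg (HXn.dist n) (map_map n (HX.map g) HX.dist u)
  rw [run, h]
  change fold n (fun w => mk (HX.map id w)) <$> _ = _
  rcases closed_or_plug n (Y := HX A B X Y) u with ⟨u₀, rfl⟩ | ⟨l, w, rfl⟩
  · rw [ext_closed, run_closed, map_pure, fold_closed]
  · rw [ext_plug, run_plug, runStep, Functor.map_map, Functor.map_map]
    congr 1
    funext v
    rw [fold_plug]
    rcases v with ⟨x, b | ⟨a, e⟩⟩ <;> rfl

theorem ext_bind_run (n : ℕ) {Y Z : Type u} (f : Y → M Z) (g : Z → M (Exec A B X))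
    (u : HXn A B X n Y) : ext n f u >>= run n g = run n (fun y => f y >>= g) u := by
  rcases closed_or_plug n u with ⟨u₀, rfl⟩ | ⟨l, y, rfl⟩
  · rw [ext_closed, run_closed, pure_bind, run_closed]
  · rw [ext_plug, run_plug, bind_map_left, map_bind]
    simp only [run_plug]

variable {Y : Type u} (d : Y → M (HX A B X Y))

/-- The `n`-step unfolding of a coalgebra. -/
def iter : (n : ℕ) → Y → M (HXn A B X n Y)
  | 0, y => pure y
  | n + 1, y => iter n y >>= ext n d

/-- One step of the coalgebra, followed by `g`. -/
def unfoldStep (g : Y → M (Exec A B X)) : Y → M (Exec A B X) :=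
  fun y => d y >>= runStep g

/-- The innermost layer of the unfolding can be absorbed into `g` by `run_succ` and `ext_bind_run`,
so the induction has to vary `g`. -/
theorem iter_bind_run (n : ℕ) (g : Y → M (Exec A B X)) (y : Y) :
    iter d n y >>= run n g = (unfoldStep d)^[n] g y := by
  induction n generalizing g with
  | zero => exact (pure_bind y (run 0 g)).trans (run_zero g y)
  | succ n ih =>
    rw [Function.iterate_succ_apply, ← ih]
    refine (bind_assoc (iter d n y) _ _).trans ?_
    congr 1
    funext u
    refine Eq.trans ?_ (ext_bind_run n d (runStep g) u)
    congr 1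
    funext v
    exact run_succ n g v

theorem unfoldStep_eq_iff (f : Y → M (Exec A B X)) :
    unfoldStep d f = f ↔
      (fun y => d y >>= fun u => HX.dist (HX.map f u)) = fun y => out <$> f y := by
  have h : unfoldStep d f = fun y => mk <$> (d y >>= fun u => HX.dist (HX.map f u)) :=
    funext fun y => (map_bind _ _ _).symm
  rw [h]
  constructor
  · intro h
    conv_rhs => rw [← h]
    simp [out_mk]
  · intro h
    funext y
    rw [congrFun h y]
    simp [mk_out]

end Monad

end Exec

/-! ### Fixed points of unfolding: uniqueness and existence -/

section Finiteness

open Branching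

namespace Branching

variable {T : Type u → Type u} [Monad T] [Branching T] [LawfulMonad T]

omit [LawfulMonad T] in
theorem exists_forall_supp {Y Z : Type u} (t : T Y) {P : Y → Z → Prop}
    (h : ∀ y ∈ supp t, ∃ z, P y z) : ∃ k : Y → Z, ∀ y ∈ supp t, P y (k y) := by
  classical
  obtain ⟨y₀, h₀⟩ := supp_nonempty t
  obtain ⟨z₀, -⟩ := h y₀ h₀
  have : Nonempty Z := ⟨z₀⟩
  choose! k hk using fun y => fun hy : y ∈ supp t => h y hy
  exact ⟨k, hk⟩

theorem exists_map_eq {Y Z : Type u} (f : Y → Z) (t : T Z) (h : supp t ⊆ Set.range f) :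
    ∃ s : T Y, f <$> s = t := by
  obtain ⟨k, hk⟩ := exists_forall_supp t (P := fun z y => f y = z) h
  refine ⟨k <$> t, ?_⟩
  rw [Functor.map_map, ← bind_pure_comp, bind_congr_supp t _ pure fun z hz => by rw [hk z hz],
    bind_pure]

theorem map_injective {Y Z : Type u} {f : Y → Z} (hf : Function.Injective f) :
    Function.Injective fun t : T Y => f <$> t := by
  intro s t h
  obtain ⟨y, -⟩ := supp_nonempty s
  have : Nonempty Y := ⟨y⟩
  have h' := congrArg (fun w => Function.invFun f <$> w) h
  simpa only [Functor.map_map, Function.leftInverse_invFun hf _, id_map'] using h'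

end Branching

namespace Exec

open HXn

variable {T : Type u → Type u} [Monad T] [Branching T] [LawfulMonad T] {A B X Y : Type u}

omit [LawfulMonad T] in
-- Every use of finite supports passes through this uniform bound.
theorem exists_nat_forall_supp {Z : Type u} {t : T Z} (ht : (supp t).Finite) {P : ℕ → Z → Prop}
    (hP : ∀ z, Monotone fun n => P n z) (h : ∀ z ∈ supp t, ∃ n, P n z) :
    ∃ n, ∀ z ∈ supp t, P n z := by
  choose! N hN using h
  obtain ⟨n, hn⟩ := (ht.image N).bddAbove
  exact ⟨n, fun z hz => hP z (hn ⟨z, hz, rfl⟩) (hN z hz)⟩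

omit [LawfulMonad T] in
theorem exists_supp_subset_range_kappa {U : T (Exec A B X)} (hU : (supp U).Finite) :
    ∃ n, supp U ⊆ Set.range (kappa n) :=
  exists_nat_forall_supp hU (P := fun n e => e ∈ Set.range (kappa n))
    (fun _ _ _ hmn h => range_kappa_mono hmn h) fun e _ => exists_mem_range_kappa e

variable (d : Y → PTilde T (HX A B X Y))

/-- Executions of bounded length in a fixed point arise after finitely many unfoldings. -/
theorem exists_mem_iter_of_isFixedPt {f : Y → PTilde T (Exec A B X)}
    (hf : unfoldStep d f = f) {y : Y} {U : T (Exec A B X)} (hU : U ∈ (f y).carrier) {n : ℕ}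
    (hn : supp U ⊆ Set.range (kappa n)) :
    ∃ t ∈ (iter d n y).carrier, ∃ s, closed n <$> s = t ∧ U = kappa n <$> s := by
  have h : iter d n y >>= run n f = f y := by
    rw [iter_bind_run, Function.iterate_fixed hf]
  rw [← h, PTilde.mem_bind] at hU
  obtain ⟨t, ht, k, hk, rfl⟩ := hU
  -- An open play in the support of `t` would contribute to `U` an execution outside the image of
  -- `kappa n`.
  have hcl : supp t ⊆ Set.range (closed n) := by
    intro u hu
    rcases closed_or_plug n u with ⟨u₀, rfl⟩ | ⟨l, z, rfl⟩
    · exact ⟨u₀, rfl⟩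
    · have hku := hk _ hu
      rw [run_plug, PTilde.carrier_map] at hku
      obtain ⟨w, -, hw⟩ := hku
      obtain ⟨e, he⟩ := supp_nonempty w
      refine absurd (hn ?_) (fold_id_plug_notMem_range_kappa n l e)
      rw [supp_bind]
      refine Set.mem_biUnion hu ?_
      rw [← hw, supp_map']
      exact ⟨e, he, rfl⟩
  obtain ⟨s, rfl⟩ := exists_map_eq _ _ hcl
  refine ⟨_, ht, s, rfl, ?_⟩
  rw [bind_map_left, ← bind_pure_comp]
  refine bind_congr_supp _ _ _ fun u hu => ?_
  have hku := hk (closed n u) (by rw [supp_map']; exact ⟨u, hu, rfl⟩)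
  rwa [run_closed] at hku

/-- Completed plays leave nothing for `g` to finish, so `g` is arbitrary and the choices in the bind
are forced. -/
theorem map_kappa_mem_iterate {g : Y → PTilde T (Exec A B X)} {n : ℕ} {y : Y}
    {s : T (HXn A B X n PEmpty.{u + 1})} (h : closed n <$> s ∈ (iter d n y).carrier) :
    kappa n <$> s ∈ ((unfoldStep d)^[n] g y).carrier := by
  rw [← iter_bind_run, PTilde.mem_bind]
  obtain ⟨k, hk⟩ := exists_forall_supp (closed n <$> s : T (HXn A B X n Y))
    (P := fun u v => ∃ u₀, u = closed n u₀ ∧ v = (pure (kappa n u₀) : T (Exec A B X))) (by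
      rw [supp_map']
      rintro _ ⟨u₀, -, rfl⟩
      exact ⟨_, u₀, rfl, rfl⟩)
  refine ⟨_, h, k, fun u hu => ?_, ?_⟩
  · obtain ⟨u₀, rfl, h'⟩ := hk u hu
    rw [run_closed, h']
    rfl
  · rw [bind_map_left, ← bind_pure_comp]
    refine bind_congr_supp _ _ _ fun u hu => ?_
    obtain ⟨u₀, h₀, h'⟩ := hk (closed n u) (by rw [supp_map']; exact ⟨u, hu, rfl⟩)
    rw [h', ← closed_injective n h₀]

theorem isFixedPt_unique (hfin : ∀ U : T (Exec A B X), (supp U).Finite)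
    {f g : Y → PTilde T (Exec A B X)} (hf : unfoldStep d f = f) (hg : unfoldStep d g = g) :
    f = g := by
  have key : ∀ {f g : Y → PTilde T (Exec A B X)}, unfoldStep d f = f → unfoldStep d g = g →
      ∀ y, (f y).carrier ⊆ (g y).carrier := by
    intro f g hf hg y U hU
    obtain ⟨n, hn⟩ := exists_supp_subset_range_kappa (hfin U)
    obtain ⟨_, ht, s, rfl, rfl⟩ := exists_mem_iter_of_isFixedPt d hf hU hn
    have := map_kappa_mem_iterate d (g := g) ht
    rwa [Function.iterate_fixed hg] at this
  funext y
  exact PTilde.ext ((key hf hg y).antisymm (key hg hf y))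

theorem runStep_mono {f g : Y → PTilde T (Exec A B X)}
    (h : ∀ y, (f y).carrier ⊆ (g y).carrier) (u : HX A B X Y) :
    (runStep f u).carrier ⊆ (runStep g u).carrier := by
  rcases u with ⟨x, b | ⟨a, y⟩⟩
  · exact subset_rfl
  · simp only [runStep, HX.dist, HX.map, Prod.map_apply, Sum.map_inr, PTilde.carrier_map]
    exact Set.image_mono (Set.image_mono (h y))

theorem unfoldStep_mono {f g : Y → PTilde T (Exec A B X)}
    (h : ∀ y, (f y).carrier ⊆ (g y).carrier) (y : Y) :
    (unfoldStep d f y).carrier ⊆ (unfoldStep d g y).carrier := by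
  intro v hv
  obtain ⟨t, ht, k, hk, rfl⟩ := PTilde.mem_bind.1 hv
  exact PTilde.mem_bind.2 ⟨t, ht, k, fun u hu => runStep_mono h u (hk u hu), rfl⟩

theorem iterate_bot_mono (y : Y) :
    Monotone fun n => ((unfoldStep d)^[n] (fun _ => ⊥) y).carrier := by
  refine monotone_nat_of_le_succ fun n => ?_
  induction n generalizing y with
  | zero => exact fun v hv => hv.elim
  | succ n ih =>
    simp only [Function.iterate_succ_apply'] at ih ⊢
    exact unfoldStep_mono d ih y

/-- The least fixed point of `unfoldStep d`, the union of its finite approximations. -/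
def lfp (hfin : ∀ (Z : Type u) (t : T Z), (supp t).Finite) (y : Y) : PTilde T (Exec A B X) where
  carrier := ⋃ n, ((unfoldStep d)^[n] (fun _ => ⊥) y).carrier
  convex := by
    rw [cl_eq_iff]
    intro I w f hf
    obtain ⟨n, hn⟩ := exists_nat_forall_supp (hfin I w)
      (P := fun n i => f i ∈ ((unfoldStep d)^[n] (fun _ => ⊥) y).carrier)
      (fun i _ _ hmn h => iterate_bot_mono d y hmn h) (fun i hi => Set.mem_iUnion.1 (hf i hi))
    exact Set.mem_iUnion.2 ⟨n, cl_eq_iff.1 (PTilde.convex _) w f hn⟩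

/-- One unfolding makes one choice per point of a finite support, so all its choices already lie in
a common approximation. -/
theorem unfoldStep_lfp (hfin : ∀ (Z : Type u) (t : T Z), (supp t).Finite) :
    unfoldStep d (lfp d hfin) = lfp d hfin := by
  have hle : ∀ n y, ((unfoldStep d)^[n] (fun _ => ⊥) y).carrier ⊆ (lfp d hfin y).carrier :=
    fun n y => Set.subset_iUnion (fun n => ((unfoldStep d)^[n] (fun _ => ⊥) y).carrier) n
  funext y
  refine PTilde.ext (Set.Subset.antisymm ?_ ?_)
  · intro v hv
    obtain ⟨t, ht, k, hk, rfl⟩ := PTilde.mem_bind.1 hv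
    obtain ⟨n, hn⟩ := exists_nat_forall_supp (hfin _ t)
      (P := fun n u => k u ∈ (runStep ((unfoldStep d)^[n] fun _ => ⊥) u).carrier)
      (fun u _ _ hmn h => runStep_mono (fun y => iterate_bot_mono d y hmn) u h) (by
        intro u hu
        have h := hk u hu
        rcases u with ⟨x, b | ⟨a, z⟩⟩
        -- When the step ends in an output, `runStep` ignores the approximation, so any index would
        -- do.
        · exact ⟨0, h⟩
        · simp only [runStep, HX.dist, HX.map, Prod.map_apply, Sum.map_inr, PTilde.carrier_map]
            at h ⊢
          obtain ⟨_, ⟨w, hw, rfl⟩, h'⟩ := h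
          obtain ⟨n, hn⟩ := Set.mem_iUnion.1 hw
          exact ⟨n, _, ⟨w, hn, rfl⟩, h'⟩)
    refine hle (n + 1) y ?_
    rw [Function.iterate_succ_apply']
    exact PTilde.mem_bind.2 ⟨t, ht, k, hn, rfl⟩
  · intro v hv
    obtain ⟨n, hn⟩ := Set.mem_iUnion.1 hv
    -- Raising the index lets one unfolding be split off even when `n = 0`.
    have : v ∈ ((unfoldStep d)^[n + 1] (fun _ => ⊥) y).carrier := iterate_bot_mono d y n.le_succ hn
    rw [Function.iterate_succ_apply'] at this
    exact unfoldStep_mono d (hle n) y this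

end Exec

end Finiteness

/-! ### Finality of the executions -/

section Final

open CategoryTheory Branching Exec

variable {T : Type u → Type u} [Monad T] [Branching T] [LawfulMonad T] {A B X : Type u}

/-- Coalgebra morphisms into the executions are the fixed points of unfolding. -/
theorem klFun_square_iff (V : Endofunctor.Coalgebra (HXbar T A B X))
    (f : V.V ⟶ (execCoalg T A B X).V) :
    V.str ≫ (HXbar T A B X).map f = f ≫ (execCoalg T A B X).str ↔
      unfoldStep (klFun V.str) (klFun f) = klFun f := by
  have h₁ : klFun (V.str ≫ (HXbar T A B X).map f) =
      fun y => klFun V.str y >>= fun u => HX.dist (HX.map (klFun f) u) := klFun_comp _ _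
  have h₂ : klFun (f ≫ (execCoalg T A B X).str) = fun y => out <$> klFun f y :=
    (klFun_comp _ _).trans (funext fun y => bind_pure_comp out (klFun f y))
  refine Iff.trans ?_ (unfoldStep_eq_iff (klFun V.str) (klFun f)).symm
  exact ⟨fun h => h₁.symm.trans ((congrArg klFun h).trans h₂),
    fun h => kl_ext (h₁.trans (h.trans h₂.symm))⟩

/-- The coalgebra of executions is final. -/
def execCoalgIsTerminal (hfin : ∀ (Z : Type u) (t : T Z), (supp t).Finite) :
    Limits.IsTerminal (execCoalg T A B X) :=
  Limits.IsTerminal.ofUniqueHom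
    (fun V => ⟨Kleisli.Hom.mk (↾ lfp (klFun V.str) hfin),
      (klFun_square_iff V _).2 (unfoldStep_lfp (klFun V.str) hfin)⟩)
    fun V m => Endofunctor.Coalgebra.Hom.ext (kl_ext (isFixedPt_unique (klFun V.str) (hfin _)
      ((klFun_square_iff V m.f).1 m.h) (unfoldStep_lfp (klFun V.str) hfin)))

theorem unfoldStep_execMap (final : Limits.IsTerminal (execCoalg T A B X))
    (c : X → PTilde T (H A B X)) :
    unfoldStep (star c) (execMap final c) = execMap final c :=
  (klFun_square_iff (starCoalg c) _).1 (final.from (starCoalg c)).h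

end Final

theorem Env.finite_supp (e : Env) {X : Type u} (t : e.T X) : (Branching.supp t).Finite := by
  cases e
  · exact NEFinPow.finite t
  · exact FinDist.finite t

/-! ### Partial and completed outcomes of a strategy -/

section Outcomes

open Branching Exec HXn

variable {T : Type u → Type u} [Monad T] [Branching T] [LawfulMonad T] {A B X : Type u}

theorem PTilde.mem_K {Y : Type u} {t v : T Y} : v ∈ (PTilde.K t).carrier ↔ v = t := by
  change v ∈ cl {t} ↔ _
  rw [cl_singleton, Set.mem_singleton_iff]

namespace Strategy

variable {c : X → PTilde T (H A B X)} {x : X} (σ : Strategy c x)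

theorem move_mem (n : ℕ) (u : σ.im n) : σ.move n u ∈ (HXn.ext n (star c) u.1).carrier :=
  σ.choose n u (PTilde.mem_K.2 rfl)

theorem plays_zero : σ.plays 0 = pure x := by
  rw [plays, playsIm, Functor.map_map]
  exact map_attach _

theorem plays_succ (n : ℕ) : σ.plays (n + 1) = σ.playsIm n >>= σ.move n := by
  rw [plays, playsIm, map_bind]
  congr 1
  funext u
  rw [step, Functor.map_map]
  exact map_attach _

theorem supp_playsIm (n : ℕ) (h : supp (σ.plays n) = σ.im n) :
    supp (σ.playsIm n) = Set.univ := by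
  rw [plays, supp_map'] at h
  refine Set.eq_univ_of_forall fun u => ?_
  obtain ⟨v, hv, hvu⟩ := h.ge u.2
  rwa [← Subtype.ext hvu]

theorem supp_plays (n : ℕ) : supp (σ.plays n) = σ.im n := by
  induction n with
  | zero => exact (congrArg supp σ.plays_zero).trans σ.im_zero.symm
  | succ n ih => rw [plays_succ, supp_bind, σ.supp_playsIm n ih, Set.biUnion_univ, σ.im_succ]

/-- Trades moves on the subtype `im n` for a total function, as binding in `PTilde T` requires;
values off the support of `plays n` do not matter. -/
theorem exists_plays_bind (n : ℕ) : ∃ k : HXn A B X n X → T (HXn A B X (n + 1) X),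
    (∀ u : σ.im n, k u.1 = σ.move n u) ∧ σ.plays (n + 1) = σ.plays n >>= k := by
  obtain ⟨k, hk⟩ := exists_forall_supp (σ.plays n)
    (P := fun u v => ∃ h : u ∈ σ.im n, σ.move n ⟨u, h⟩ = v) (by
      rw [supp_plays]
      exact fun u hu => ⟨_, hu, rfl⟩)
  rw [supp_plays] at hk
  have hk' : ∀ u : σ.im n, k u.1 = σ.move n u := fun u => (hk u.1 u.2).2.symm
  refine ⟨k, hk', ?_⟩
  rw [plays_succ, plays, bind_map_left]
  congr 1
  funext u
  exact (hk' u).symm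

theorem plays_mem_iter (n : ℕ) : σ.plays n ∈ (iter (star c) n x).carrier := by
  induction n with
  | zero => rw [plays_zero]; rfl
  | succ n ih =>
    obtain ⟨k, hk, h⟩ := σ.exists_plays_bind n
    refine PTilde.mem_bind.2 ⟨_, ih, k, fun u hu => ?_, h⟩
    rw [supp_plays] at hu
    rw [hk ⟨u, hu⟩]
    exact σ.move_mem n ⟨u, hu⟩

/-- Truncating the last step recovers the previous outcome, by the condition `extend`; this allows
descent from step `n + 1` to step `n`. -/
theorem plays_succ_bind (n : ℕ) :
    (σ.plays (n + 1) >>= HXn.ext n (fun w : HX A B X X => (pure w.1 : T X))) = σ.plays n := by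
  rw [plays_succ]
  refine (bind_assoc (σ.playsIm n) (σ.move n) _).trans ?_
  simp only [σ.extend, bind_pure_comp]
  rfl

/-- Completed plays are not extended any further. -/
theorem closed_plays_succ_iff (n : ℕ) (s : T (HXn A B X n PEmpty.{u + 1})) :
    closed (n + 1) <$> (lift n <$> s) = σ.plays (n + 1) ↔ closed n <$> s = σ.plays n := by
  rw [Functor.map_map]
  simp only [closed_lift]
  constructor
  · intro h
    rw [← plays_succ_bind, ← h]
    refine Eq.symm ((bind_map_left _ _ _).trans ?_)
    simp only [ext_closed, bind_pure_comp]
  · intro h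
    obtain ⟨k, hk, hk'⟩ := σ.exists_plays_bind n
    rw [hk', ← h, bind_map_left]
    refine (bind_pure_comp _ _).symm.trans ?_
    refine bind_congr_supp _ _ _ fun u hu => ?_
    have hu' : closed n u ∈ σ.im n := by
      rw [← supp_plays, ← h, supp_map']
      exact ⟨u, hu, rfl⟩
    -- At a completed play the set of permitted moves is a singleton: staying there.
    have hm := σ.move_mem n ⟨_, hu'⟩
    rw [ext_closed, ← hk] at hm
    exact hm.symm

/-- An open play is sent to `⊥` and admits no choice; a completed play admits exactly one. -/
theorem mem_cone {n : ℕ} {v : T (HXn A B X n PEmpty.{u + 1})} :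
    v ∈ (σ.cone n).carrier ↔ closed n <$> v = σ.plays n := by
  rw [cone, PTilde.mem_bind]
  constructor
  · rintro ⟨t, ht, k, hk, rfl⟩
    rw [PTilde.mem_K] at ht
    subst ht
    rw [map_bind]
    conv_rhs => rw [← bind_pure (σ.plays n)]
    refine bind_congr_supp _ _ _ fun u hu => ?_
    have h := hk u hu
    rcases closed_or_plug n u with ⟨u₀, rfl⟩ | ⟨l, y, rfl⟩
    · rw [ext_closed, closed_self, PTilde.carrier_pure, Set.mem_singleton_iff] at h
      rw [h, map_pure]
    · rw [ext_plug, PTilde.carrier_map] at h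
      obtain ⟨_, h, -⟩ := h
      exact h.elim
  · intro h
    obtain ⟨k, hk⟩ := exists_forall_supp (σ.plays n)
      (P := fun u w => ∃ u₀, u = closed n u₀ ∧
        w = (pure u₀ : T (HXn A B X n PEmpty.{u + 1}))) (by
        rw [← h, supp_map']
        rintro _ ⟨u₀, -, rfl⟩
        exact ⟨_, u₀, rfl, rfl⟩)
    refine ⟨_, PTilde.mem_K.2 rfl, k, fun u hu => ?_, ?_⟩
    · obtain ⟨u₀, rfl, h'⟩ := hk u hu
      rw [ext_closed, h', closed_self]
      rfl
    · conv_lhs => rw [← bind_pure v]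
      rw [← h, bind_map_left]
      refine bind_congr_supp _ _ _ fun u hu => ?_
      obtain ⟨u₀, h₀, h'⟩ := hk (closed n u) (by rw [← h, supp_map']; exact ⟨u, hu, rfl⟩)
      rw [h', closed_injective n h₀]

/-- `U` collects the plays of the strategy, all of them completed after `n` steps. -/
def CompletesAt (n : ℕ) (U : T (Exec A B X)) : Prop :=
  ∃ s, closed n <$> s = σ.plays n ∧ U = kappa n <$> s

theorem completesAt_mono {U : T (Exec A B X)} : Monotone fun n => σ.CompletesAt n U :=
  monotone_nat_of_le_succ fun n => by
    rintro ⟨s, hs, rfl⟩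
    refine ⟨lift n <$> s, (σ.closed_plays_succ_iff n s).2 hs, ?_⟩
    rw [Functor.map_map]
    simp only [kappa_lift]

theorem completesAt_unique {m n : ℕ} {U V : T (Exec A B X)} (hU : σ.CompletesAt m U)
    (hV : σ.CompletesAt n V) : U = V := by
  obtain ⟨s, hs, rfl⟩ := σ.completesAt_mono (le_max_left m n) hU
  obtain ⟨t, ht, rfl⟩ := σ.completesAt_mono (le_max_right m n) hV
  rw [map_injective (closed_injective _) (hs.trans ht.symm)]

/-- If the executions in `U` are short enough for `kappa n`, the plays were already completed at
step `n`: injectivity of `kappa` shows that they are lifts, and lifts descend step by step. -/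
theorem completesAt_of_supp_subset {m n : ℕ} {U : T (Exec A B X)} (h : σ.CompletesAt m U)
    (hU : supp U ⊆ Set.range (kappa n)) : σ.CompletesAt n U := by
  rcases le_total m n with hmn | hnm
  · exact σ.completesAt_mono hmn h
  · induction m, hnm using Nat.le_induction with
    | base => exact h
    | succ m hnm ih =>
      refine ih ?_
      obtain ⟨s, hs, rfl⟩ := h
      obtain ⟨t, ht⟩ := exists_map_eq _ _ (hU.trans (range_kappa_mono hnm))
      have hst : lift m <$> t = s := by
        refine map_injective (kappa_injective (m + 1)) ?_
        simp only [Functor.map_map, kappa_lift]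
        exact ht
      refine ⟨t, (σ.closed_plays_succ_iff m t).1 (by rw [hst, hs]), ht.symm⟩

/-- The union of the completed cones has at most one element, so the closure in the join adds
nothing. -/
theorem mem_outcome {U : T (Exec A B X)} :
    U ∈ σ.outcome.carrier ↔ ∃ n, σ.CompletesAt n U := by
  have h : ⋃ n, (σ.cone n >>= fun u => pure (kappa n u)).carrier =
      {U | ∃ n, σ.CompletesAt n U} := by
    ext V
    simp only [Set.mem_iUnion, Set.mem_ofPred_eq, bind_pure_comp, PTilde.carrier_map, Set.mem_image,
      mem_cone, CompletesAt, eq_comm (a := V)]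
  change U ∈ cl (⋃ n, (σ.cone n >>= fun u => pure (kappa n u)).carrier) ↔ _
  rw [h]
  by_cases hV : ∃ V n, σ.CompletesAt n V
  · obtain ⟨V, n, hV⟩ := hV
    have h' : {U | ∃ n, σ.CompletesAt n U} = {V} := by
      ext W
      constructor
      · rintro ⟨m, hm⟩
        exact σ.completesAt_unique hm hV
      · rintro rfl
        exact ⟨n, hV⟩
    rw [h', cl_singleton, ← h']
    rfl
  · push Not at hV
    have h' : {U | ∃ n, σ.CompletesAt n U} = ∅ :=
      Set.eq_empty_of_forall_notMem fun V ⟨n, hn⟩ => hV V n hn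
    rw [h', cl_empty, ← h']
    rfl

theorem outcome_eq_singleton {n : ℕ} {U : T (Exec A B X)} (h : σ.CompletesAt n U) :
    σ.outcome.carrier = {U} := by
  ext V
  rw [mem_outcome]
  constructor
  · rintro ⟨m, hm⟩
    exact σ.completesAt_unique hm h
  · rintro rfl
    exact ⟨n, h⟩

theorem finitelyCompleting_of_completesAt {n : ℕ} {U : T (Exec A B X)}
    (h : σ.CompletesAt n U) : σ.FinitelyCompleting := by
  obtain ⟨s, hs, -⟩ := h
  refine ⟨n, ?_⟩
  rw [← supp_plays, ← hs, supp_map']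
  exact Set.image_subset_range _ _

end Strategy

/-! ### Projections and the characterisation of outcomes -/

theorem mem_bind_piProj {m : PTilde T (Exec A B X)} {n : ℕ}
    {v : T (HXn A B X n PEmpty.{u + 1})} :
    v ∈ (m >>= piProj n).carrier ↔ kappa n <$> v ∈ m.carrier := by
  have hpi : ∀ u : HXn A B X n PEmpty.{u + 1}, (piProj n (kappa n u) : PTilde T _) = pure u := by
    intro u
    have h : ∃ w, kappa n w = kappa n u := ⟨u, rfl⟩
    rw [piProj, dif_pos h, kappa_injective n h.choose_spec]
  rw [PTilde.mem_bind]
  constructor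
  · rintro ⟨U, hU, k, hk, rfl⟩
    convert hU
    rw [map_bind]
    conv_rhs => rw [← bind_pure U]
    refine bind_congr_supp _ _ _ fun e he => ?_
    have h := hk e he
    by_cases hr : ∃ u, kappa n u = e
    · obtain ⟨u, rfl⟩ := hr
      rw [hpi] at h
      rw [Set.mem_singleton_iff.1 h, map_pure]
    · rw [piProj, dif_neg hr] at h
      exact h.elim
  · intro h
    obtain ⟨k, hk⟩ := exists_forall_supp (kappa n <$> v : T (Exec A B X))
      (P := fun e w => ∃ u, e = kappa n u ∧
        w = (pure u : T (HXn A B X n PEmpty.{u + 1}))) (by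
        rw [supp_map']
        rintro _ ⟨u, -, rfl⟩
        exact ⟨_, u, rfl, rfl⟩)
    refine ⟨_, h, k, fun e he => ?_, ?_⟩
    · obtain ⟨u, rfl, h'⟩ := hk e he
      rw [hpi, h']
      rfl
    · conv_lhs => rw [← bind_pure v]
      rw [bind_map_left]
      refine bind_congr_supp _ _ _ fun u hu => ?_
      obtain ⟨u₀, h₀, h'⟩ := hk (kappa n u) (by rw [supp_map']; exact ⟨u, hu, rfl⟩)
      rw [h', kappa_injective n h₀]

namespace Strategy

variable {c : X → PTilde T (H A B X)} {x : X}

theorem bind_piProj_eq_cone_iff (hfin : ∀ U : T (Exec A B X), (supp U).Finite)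
    (σ : Strategy c x) (m : PTilde T (Exec A B X)) :
    (∀ n, (m >>= piProj n) = σ.cone n) ↔ m = σ.outcome := by
  constructor
  · intro h
    have h' : ∀ n v, kappa n <$> v ∈ m.carrier ↔ closed n <$> v = σ.plays n := fun n v => by
      rw [← mem_bind_piProj, h, mem_cone]
    ext U
    rw [mem_outcome]
    constructor
    · intro hU
      obtain ⟨n, hn⟩ := exists_supp_subset_range_kappa (hfin U)
      obtain ⟨s, rfl⟩ := exists_map_eq _ _ hn
      exact ⟨n, s, (h' n s).1 hU, rfl⟩
    · rintro ⟨n, s, hs, rfl⟩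
      exact (h' n s).2 hs
  · rintro rfl n
    ext v
    rw [mem_bind_piProj, mem_cone, mem_outcome]
    constructor
    · rintro ⟨m, hm⟩
      obtain ⟨s, hs, h⟩ := σ.completesAt_of_supp_subset hm (n := n) (by
        rw [supp_map']
        exact Set.image_subset_range _ _)
      rwa [map_injective (kappa_injective n) h]
    · intro h
      exact ⟨n, v, h, rfl⟩

/-! ### Strategies built from moves -/

/-- The partial outcomes of a sequence of moves. -/
def outcomes (x : X) (h : ∀ n, HXn A B X n X → T (HXn A B X (n + 1) X)) :
    (n : ℕ) → T (HXn A B X n X)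
  | 0 => pure x
  | n + 1 => outcomes x h n >>= h n

omit [Branching T] [LawfulMonad T] in
theorem outcomes_congr {h k : ∀ n, HXn A B X n X → T (HXn A B X (n + 1) X)} (n : ℕ)
    (hk : ∀ m < n, h m = k m) : outcomes x h n = outcomes x k n := by
  induction n with
  | zero => rfl
  | succ n ih =>
    rw [outcomes, outcomes, ih fun m hm => hk m (hm.trans n.lt_succ_self), hk n n.lt_succ_self]

/-- A permitted move extends its play automatically: `star c` records the current state, so
truncation is constant on the support of the move, and `bind_const` collapses it. -/
theorem extend_of_mem (n : ℕ) (u : HXn A B X n X) (t : T (HXn A B X (n + 1) X))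
    (ht : t ∈ (HXn.ext n (star c) u).carrier) :
    (t >>= HXn.ext n (fun w : HX A B X X => (pure w.1 : T X))) = pure u := by
  rcases closed_or_plug n u with ⟨u₀, rfl⟩ | ⟨l, y, rfl⟩
  · rw [ext_closed] at ht
    obtain rfl : t = pure (closed n u₀ : HXn A B X n (HX A B X X)) := ht
    refine (pure_bind (m := T) _ _).trans ?_
    exact ext_closed n _ u₀
  · rw [ext_plug, _root_.star, Functor.map_map, PTilde.carrier_map] at ht
    obtain ⟨s, -, rfl⟩ := ht
    refine (bind_map_left _ _ _).trans ?_
    simp only [ext_plug, map_pure]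
    exact bind_const s _

/-- The strategy given by moves defined on all plays. -/
def ofMoves (h : ∀ n, HXn A B X n X → T (HXn A B X (n + 1) X))
    (hh : ∀ n, ∀ u ∈ supp (outcomes x h n), h n u ∈ (HXn.ext n (star c) u).carrier) :
    Strategy c x where
  im n := supp (outcomes x h n)
  move n u := h n u.1
  im_zero := rfl
  im_succ n := by
    rw [outcomes, supp_bind, Set.biUnion_eq_iUnion]
  extend n u := extend_of_mem n u.1 _ (hh n u.1 u.2)
  choose n u := fun v hv => by
    rw [PTilde.mem_K.1 hv]
    exact hh n u.1 u.2

theorem plays_ofMoves (h : ∀ n, HXn A B X n X → T (HXn A B X (n + 1) X))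
    (hh : ∀ n, ∀ u ∈ supp (outcomes x h n), h n u ∈ (HXn.ext n (star c) u).carrier) (n : ℕ) :
    (ofMoves (c := c) h hh).plays n = outcomes x h n := by
  induction n with
  | zero => exact plays_zero _
  | succ n ih =>
    rw [plays_succ, outcomes, ← ih, plays, bind_map_left]
    rfl

/-- Outcomes up to step `n` ignore the moves from step `n` on, so the choices can be installed one
step at a time while `h₀` prescribes the continuation. -/
theorem exists_moves_of_mem_iter (h₀ : ∀ n, HXn A B X n X → T (HXn A B X (n + 1) X)) (n : ℕ)
    {t : T (HXn A B X n X)} (ht : t ∈ (iter (star c) n x).carrier) :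
    ∃ h : ∀ n, HXn A B X n X → T (HXn A B X (n + 1) X), outcomes x h n = t ∧
      (∀ m < n, ∀ u ∈ supp (outcomes x h m), h m u ∈ (HXn.ext m (star c) u).carrier) ∧
      ∀ m, n ≤ m → h m = h₀ m := by
  induction n with
  | zero => exact ⟨h₀, ht.symm, fun m hm => absurd hm m.not_lt_zero, fun _ _ => rfl⟩
  | succ n ih =>
    obtain ⟨s, hs, k, hk, rfl⟩ := PTilde.mem_bind.1 ht
    obtain ⟨h, rfl, hh, h'⟩ := ih hs
    have hlt : ∀ m ≤ n, outcomes x (Function.update h n k) m = outcomes x h m := fun m hm =>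
      outcomes_congr m fun i hi => Function.update_of_ne (hi.trans_le hm).ne _ _
    refine ⟨Function.update h n k, ?_, fun m hm => ?_, fun m hm => ?_⟩
    · rw [outcomes, hlt n le_rfl, Function.update_self]
    · rw [hlt m (Nat.le_of_lt_succ hm)]
      rcases (Nat.le_of_lt_succ hm).lt_or_eq with hmn | rfl
      · rw [Function.update_of_ne hmn.ne]
        exact hh m hmn
      · rw [Function.update_self]
        exact hk
    · rw [Function.update_of_ne (Nat.lt_of_succ_le hm).ne']
      exact h' m (n.le_succ.trans hm)

/-- A completed outcome of finitely many unfoldings is the outcome of a strategy, which makes no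
moves afterwards. -/
theorem exists_plays_eq {n : ℕ} {s : T (HXn A B X n PEmpty.{u + 1})}
    (hs : closed n <$> s ∈ (iter (star c) n x).carrier) :
    ∃ σ : Strategy c x, σ.plays n = closed n <$> s := by
  obtain ⟨u₀, -⟩ := supp_nonempty s
  -- Moves after step `n` stand still on completed plays. On open plays the value is junk, and it
  -- exists because the support of `s` yields an execution.
  have stay : ∀ m, ∃ k : HXn A B X m X → T (HXn A B X (m + 1) X),
      ∀ v, k (closed m v) = pure (closed m v : HXn A B X m (HX A B X X)) := by
    intro m
    classical
    obtain ⟨w⟩ : Nonempty (HXn A B X (m + 1) X) := nonempty_succ (kappa n u₀) m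
    refine ⟨fun u => if h : ∃ v, closed m v = u then
      pure (closed m h.choose : HXn A B X m (HX A B X X)) else pure w, fun v => ?_⟩
    have h : ∃ v', (closed m v' : HXn A B X m X) = closed m v := ⟨v, rfl⟩
    exact (dif_pos h).trans (congrArg
      (fun v => (pure (closed m v : HXn A B X m (HX A B X X)) : T (HXn A B X m (HX A B X X))))
      (closed_injective m h.choose_spec))
  choose h₀ hh₀ using stay
  obtain ⟨h, hn, hh, h'⟩ := exists_moves_of_mem_iter h₀ n hs
  -- No open play is reached from step `n` on, so the junk moves never need to be permitted by `c`.
  have hcl : ∀ m, n ≤ m → supp (outcomes x h m) ⊆ Set.range (closed m) := by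
    intro m hm
    induction m, hm using Nat.le_induction with
    | base =>
      rw [hn, supp_map']
      exact Set.image_subset_range _ _
    | succ m hm ih =>
      rw [outcomes, supp_bind, h' m hm]
      refine Set.iUnion₂_subset fun u hu => ?_
      obtain ⟨v, rfl⟩ := ih hu
      rw [hh₀]
      refine (supp_pure _).trans_subset (Set.singleton_subset_iff.2 ?_)
      exact ⟨lift m v, closed_lift m v⟩
  refine ⟨ofMoves h fun m u hu => ?_, (plays_ofMoves h _ n).trans hn⟩
  rcases lt_or_ge m n with hm | hm
  · exact hh m hm u hu
  · obtain ⟨v, rfl⟩ := hcl m hm hu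
    rw [ext_closed, h' m hm, hh₀]
    rfl

end Strategy

/-! ### Executions are strategies -/

/-- Executions are the outcomes of strategies. -/
theorem mem_execMap_iff (hfin : ∀ U : T (Exec A B X), (supp U).Finite)
    (final : CategoryTheory.Limits.IsTerminal (execCoalg T A B X)) (c : X → PTilde T (H A B X))
    (x : X) (U : T (Exec A B X)) :
    U ∈ (execMap final c x).carrier ↔ ∃ (σ : Strategy c x) (n : ℕ), σ.CompletesAt n U := by
  have hfix := unfoldStep_execMap final c
  constructor
  · intro hU
    obtain ⟨n, hn⟩ := exists_supp_subset_range_kappa (hfin U)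
    obtain ⟨_, ht, s, rfl, rfl⟩ := exists_mem_iter_of_isFixedPt (star c) hfix hU hn
    obtain ⟨σ, hσ⟩ := Strategy.exists_plays_eq ht
    exact ⟨σ, n, s, hσ.symm, rfl⟩
  · rintro ⟨σ, n, s, hs, rfl⟩
    have h := map_kappa_mem_iterate (star c) (g := execMap final c)
      (show closed n <$> s ∈ _ from hs ▸ σ.plays_mem_iter n)
    rwa [Function.iterate_fixed hfix] at h

end Outcomes

theorem mainTheorem1 (e : Env) {A B X : Type u} (c : X → PTilde e.T (H A B X)) :
    ∃ final : CategoryTheory.Limits.IsTerminal (execCoalg e.T A B X),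
      (∀ (x : X) (σ : Strategy c x) (m : PTilde e.T (Exec A B X)),
        (∀ n, (m >>= piProj n) = σ.cone n) ↔ m = σ.outcome) ∧
      (∀ x : X, (execMap final c x).carrier = ⋃ σ : Strategy c x, σ.outcome.carrier) ∧
      (∀ (x : X) (U : e.T (Exec A B X)), U ∈ (execMap final c x).carrier ↔
        ∃ σ : Strategy c x, σ.FinitelyCompleting ∧ σ.outcome.carrier = {U}) := by
  have hfin : ∀ (Z : Type u) (t : e.T Z), (Branching.supp t).Finite := fun _ => e.finite_supp
  refine ⟨execCoalgIsTerminal hfin, fun _ => Strategy.bind_piProj_eq_cone_iff (hfin _), ?_, ?_⟩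
  · intro x
    ext U
    rw [mem_execMap_iff (hfin _), Set.mem_iUnion]
    simp only [Strategy.mem_outcome]
  · intro x U
    rw [mem_execMap_iff (hfin _)]
    constructor
    · rintro ⟨σ, n, h⟩
      exact ⟨σ, σ.finitelyCompleting_of_completesAt h, σ.outcome_eq_singleton h⟩
    · rintro ⟨σ, -, h⟩
      exact ⟨σ, σ.mem_outcome.1 (h ▸ Set.mem_singleton U)⟩
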